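/- Let $d\ge 1$. A convex body is a compact convex set $C\subset\mathbb{R}^d$ with nonempty interior; a homothet of $C$ is a set $\lambda C+x$ with $\lambda>0$, $x\in\mathbb{R}^d$. Measures are Borel measures on $\mathbb{R}^d$ that are finite on compact sets; $\mu$ is non-$C$-degenerate if $\mu(\partial C')=0$ for every homothet $C'$ of $C$. Let $c_{f,d}\in[0,\infty]$ be the least constant with the following property: for every convex body $C\subset\mathbb{R}^d$, every finite non-$C$-degenerate measure $\mu$, every open ball $K$ with $\mu(K)=\mu(\mathbb{R}^d)$ and every real $k$ with $0<k\le\mu(\mathbb{R}^d)$, the least number $f(C,k,\mu)$ of homothets of $C$ of $\mu$-measure at most $k$ whose union contains $K$ satisfies $f(C,k,\mu)\le c_{f,d}\,\mu(\mathbb{R}^d)/k$. For a convex body $C$ and a non-$C$-degenerate measure $\mu$ with $\mu(C)>0$, define the homothety covering density $$\Theta_H(\mu,C)=\inf_{\mathcal F}\ \liminf_{r\to\infty}\ \frac{1}{\mu(rB^d)}\sum_{A\in\mathcal F,\ A\subset rB^d}\mu(A),$$ where $B^d$ is the open Euclidean unit ball centered at the origin and $\mathcal F$ runs over all families of homothets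 of $C$ of measure exactly $\mu(C)$ whose union is $\mathbb{R}^d$. Theorem. For every $d\ge1$ the constant $c_{f,d}$ is finite, and for every convex body $C\subset\mathbb{R}^d$ and every non-$C$-degenerate measure $\mu$ with $\mu(C)>0$ and $\mu(\mathbb{R}^d)=\infty$, $$\Theta_H(\mu,C)\le c_{f,d}.$$ In particular, $\Theta_H(\mu,C)$ is bounded from above by a function of $d$ only. -/

import Mathlib

open Set Filter Topology MeasureTheory
open scoped NNReal ENNReal

/-- A convex body in `ℝ^d`: a compact convex set with nonempty interior. -/
structure IsConvexBody {d : ℕ} (C : Set (EuclideanSpace ℝ (Fin d))) : Prop where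
  convex : Convex ℝ C
  isCompact : IsCompact C
  interior_nonempty : (interior C).Nonempty

/-- `A` is a (positive) homothet of `C`, that is, `A = λ C + x` with `λ > 0`. -/
def IsHomothet {d : ℕ} (C A : Set (EuclideanSpace ℝ (Fin d))) : Prop :=
  ∃ (l : ℝ) (x : EuclideanSpace ℝ (Fin d)), 0 < l ∧ A = (fun c => l • c + x) '' C

/-- `μ` vanishes on the boundary of every homothet of `C`. -/
def NonDegenerate {d : ℕ} (C : Set (EuclideanSpace ℝ (Fin d)))
    (μ : Measure (EuclideanSpace ℝ (Fin d))) : Prop :=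
  ∀ A, IsHomothet C A → μ (frontier A) = 0

/-- The least number of homothets of `C` of `μ`-measure at most `k` that cover `K`
(`⊤` if no finite number suffices). -/
noncomputable def coverNumber {d : ℕ} (C : Set (EuclideanSpace ℝ (Fin d))) (k : ℝ≥0)
    (μ : Measure (EuclideanSpace ℝ (Fin d))) (K : Set (EuclideanSpace ℝ (Fin d))) : ℕ∞ :=
  ⨅ (F : Set (Set (EuclideanSpace ℝ (Fin d))))
    (_ : (∀ A ∈ F, IsHomothet C A ∧ μ A ≤ k) ∧ K ⊆ ⋃₀ F), F.encard

/-- `c` is a constant for the covering bound `f(C, k, μ) ≤ c μ(ℝ^d) / k`, for all convex bodies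
`C`, all finite non-`C`-degenerate measures `μ` that are carried by an open ball `K`, and all real
`k` with `0 < k ≤ μ(ℝ^d)`; here `f(C, k, μ)` is the covering number of `K`. -/
def IsCoverBound (d : ℕ) (c : ℝ≥0∞) : Prop :=
  ∀ (C : Set (EuclideanSpace ℝ (Fin d))) (μ : Measure (EuclideanSpace ℝ (Fin d)))
    (x : EuclideanSpace ℝ (Fin d)) (r : ℝ) (k : ℝ≥0),
    IsConvexBody C → μ univ < ∞ → NonDegenerate C μ →
    0 < r → μ (Metric.ball x r) = μ univ →
    0 < k → (k : ℝ≥0∞) ≤ μ univ →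
    (coverNumber C k μ (Metric.ball x r) : ℝ≥0∞) ≤ c * (μ univ / k)

/-- The constant `c_{f,d}`: the least constant for the covering bound in dimension `d`. -/
noncomputable def coverConstant (d : ℕ) : ℝ≥0∞ := sInf {c | IsCoverBound d c}

/-- The inner density of the family `F` in `D` with respect to `μ`. -/
noncomputable def innerDensity {d : ℕ} (μ : Measure (EuclideanSpace ℝ (Fin d)))
    (F : Set (Set (EuclideanSpace ℝ (Fin d)))) (D : Set (EuclideanSpace ℝ (Fin d))) : ℝ≥0∞ :=
  (∑' A : {A : Set (EuclideanSpace ℝ (Fin d)) // A ∈ F ∧ A ⊆ D}, μ A.1) / μ D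

/-- The lower density of the family `F` with respect to `μ`. -/
noncomputable def lowerDensity {d : ℕ} (μ : Measure (EuclideanSpace ℝ (Fin d)))
    (F : Set (Set (EuclideanSpace ℝ (Fin d)))) : ℝ≥0∞ :=
  liminf (fun r : ℝ => innerDensity μ F (Metric.ball 0 r)) atTop

/-- `F` is a covering of `ℝ^d` with homothets of `C` of measure `μ(C)`. -/
def IsHomothetCovering {d : ℕ} (μ : Measure (EuclideanSpace ℝ (Fin d)))
    (C : Set (EuclideanSpace ℝ (Fin d))) (F : Set (Set (EuclideanSpace ℝ (Fin d)))) : Prop :=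
  (∀ A ∈ F, IsHomothet C A ∧ μ A = μ C) ∧ ⋃₀ F = univ

/-- The homothety covering density `Θ_H(μ, C)`. -/
noncomputable def homothetyCoveringDensity {d : ℕ} (μ : Measure (EuclideanSpace ℝ (Fin d)))
    (C : Set (EuclideanSpace ℝ (Fin d))) : ℝ≥0∞ :=
  ⨅ (F : Set (Set (EuclideanSpace ℝ (Fin d)))) (_ : IsHomothetCovering μ C F), lowerDensity μ F

/-! Finiteness of the constant is a Besicovitch-type argument. By Helly's theorem `C` has a center
of asymmetry at most `d` (`exists_center`). Since boundaries are null, the measure of a dilate is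
continuous in the ratio, so every point of the ball is the center of a homothet of measure exactly
`k`. Choosing uncovered centers greedily, with nearly maximal ratio, gives sets that meet any point
boundedly often, by a volume argument (`card_le_of_centers_not_mem`). Summing measures bounds how
many are chosen (`isCoverBound_natCast`).

For the density, the bound is applied to `μ` restricted to a large ball, with `k'` slightly below `μ
C`. Each resulting set is replaced by homothets of measure exactly `μ C`, at most one of them inside
the ball (`exists_finite_cover_measure_eq`), so the number inside does not grow. Such covers of
rapidly growing balls are glued into one covering of the space. Since `μ` is infinite, the earlier
stages are negligible in the next ball (`homothetyCoveringDensity_le_of_forall_exists`). -/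

/-- The homothetic copy of `A` with center `x` and ratio `t`, for `t ≠ 0`. -/
def dilate {E : Type*} [AddCommGroup E] [Module ℝ E] (A : Set E) (x : E) (t : ℝ) : Set E :=
  {y | t⁻¹ • (y - x) + x ∈ A}

/-! ### Homothets and the dependence of their measure on the ratio -/

section Homothets

variable {d : ℕ} {C A B : Set (EuclideanSpace ℝ (Fin d))} {x : EuclideanSpace ℝ (Fin d)} {t : ℝ}

theorem IsHomothet.trans (h₁ : IsHomothet C A) (h₂ : IsHomothet A B) : IsHomothet C B := by
  obtain ⟨l, x, hl, rfl⟩ := h₁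
  obtain ⟨m, y, hm, rfl⟩ := h₂
  refine ⟨m * l, m • x + y, mul_pos hm hl, ?_⟩
  rw [image_image]
  refine image_congr fun c _ => ?_
  simp only [smul_add, mul_smul, add_assoc]

/-- The homeomorphism `c ↦ l • c + x`. -/
noncomputable def homothetHomeomorph (l : ℝ) (hl : l ≠ 0) (x : EuclideanSpace ℝ (Fin d)) :
    EuclideanSpace ℝ (Fin d) ≃ₜ EuclideanSpace ℝ (Fin d) :=
  (Homeomorph.smulOfNeZero l hl).trans (Homeomorph.addRight x)

theorem homothetHomeomorph_coe (l : ℝ) (hl : l ≠ 0) (x : EuclideanSpace ℝ (Fin d)) :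
    ⇑(homothetHomeomorph l hl x) = fun c => l • c + x := rfl

theorem IsHomothet.isConvexBody (hC : IsConvexBody C) (h : IsHomothet C A) : IsConvexBody A := by
  obtain ⟨l, x, hl, rfl⟩ := h
  refine ⟨?_, ?_, ?_⟩
  · have : (fun c : EuclideanSpace ℝ (Fin d) => l • c + x) '' C
        = (fun c => c + x) '' ((fun c => l • c) '' C) := by rw [image_image]
    rw [this]
    simpa [add_comm, ← image_smul] using (hC.convex.smul l).translate x
  · exact hC.isCompact.image (by fun_prop)
  · rw [← homothetHomeomorph_coe l hl.ne' x, ← Homeomorph.image_interior]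
    exact hC.interior_nonempty.image _

theorem NonDegenerate.of_isHomothet {μ : Measure (EuclideanSpace ℝ (Fin d))}
    (hμ : NonDegenerate C μ) (h : IsHomothet C A) : NonDegenerate A μ :=
  fun B hB => hμ B (h.trans hB)

theorem NonDegenerate.restrict {μ : Measure (EuclideanSpace ℝ (Fin d))}
    (hμ : NonDegenerate C μ) (s : Set (EuclideanSpace ℝ (Fin d))) :
    NonDegenerate C (μ.restrict s) :=
  fun B hB => le_antisymm ((Measure.restrict_apply_le s _).trans (hμ B hB).le) zero_le

theorem isHomothet_dilate (A : Set (EuclideanSpace ℝ (Fin d))) (x : EuclideanSpace ℝ (Fin d))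
    (ht : 0 < t) : IsHomothet A (dilate A x t) := by
  refine ⟨t, x - t • x, ht, ?_⟩
  ext y
  simp only [dilate, mem_ofPred_eq, mem_image]
  constructor
  · intro h
    refine ⟨_, h, ?_⟩
    rw [smul_add, smul_inv_smul₀ ht.ne']
    abel
  · rintro ⟨a, ha, rfl⟩
    convert ha
    rw [show t • a + (x - t • x) - x = t • (a - x) by rw [smul_sub]; abel,
      inv_smul_smul₀ ht.ne']
    abel

theorem isHomothet_translate (C : Set (EuclideanSpace ℝ (Fin d)))
    (x : EuclideanSpace ℝ (Fin d)) : IsHomothet C ((fun c => c + x) '' C) :=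
  ⟨1, x, one_pos, by simp⟩

theorem dilate_one (A : Set (EuclideanSpace ℝ (Fin d))) (x : EuclideanSpace ℝ (Fin d)) :
    dilate A x 1 = A := by
  ext y; simp [dilate]

theorem dilate_mono_right (hA : Convex ℝ A) (hx : x ∈ A) {s t : ℝ} (hs : 0 < s) (hst : s ≤ t) :
    dilate A x s ⊆ dilate A x t := by
  intro y hy
  have ht := hs.trans_le hst
  have h := hA hy hx (a := s / t) (b := 1 - s / t) (by positivity)
    (by rw [sub_nonneg, div_le_one ht]; exact hst) (by ring)
  simp only [dilate, mem_ofPred_eq]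
  convert h using 1
  rw [smul_add, smul_smul, show s / t * s⁻¹ = t⁻¹ by field_simp, sub_smul, one_smul]
  abel

theorem mem_interior_dilate (hx : x ∈ interior A) : x ∈ interior (dilate A x t) := by
  have hc : Continuous fun y : EuclideanSpace ℝ (Fin d) => t⁻¹ • (y - x) + x := by fun_prop
  exact preimage_interior_subset_interior_preimage hc (by simpa using hx)

theorem subset_interior_dilate (hA : Convex ℝ A) (hx : x ∈ interior A) (ht : 1 < t) :
    A ⊆ interior (dilate A x t) := by
  have h0 : 0 < t := one_pos.trans ht
  intro y hy
  have hc : Continuous fun y : EuclideanSpace ℝ (Fin d) => t⁻¹ • (y - x) + x := by fun_prop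
  refine preimage_interior_subset_interior_preimage hc ?_
  have := hA.combo_interior_self_mem_interior hx hy (a := 1 - t⁻¹) (b := t⁻¹)
    (by rw [sub_pos]; exact inv_lt_one_of_one_lt₀ ht) (by positivity) (by ring)
  simp only [mem_preimage]
  convert this using 1
  rw [smul_sub, sub_smul, one_smul]
  abel

theorem ball_subset_dilate {ρ : ℝ} (hA : Metric.ball x ρ ⊆ A) (ht : 0 < t) :
    Metric.ball x (t * ρ) ⊆ dilate A x t := by
  intro y hy
  refine hA ?_
  rw [Metric.mem_ball, dist_eq_norm] at hy ⊢
  rw [add_sub_cancel_right, norm_smul, norm_inv, Real.norm_of_nonneg ht.le, inv_mul_lt_iff₀ ht]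
  exact hy

theorem IsConvexBody.isCompact_dilate (hA : IsConvexBody A) (x : EuclideanSpace ℝ (Fin d))
    (ht : 0 < t) : IsCompact (dilate A x t) :=
  ((isHomothet_dilate A x ht).isConvexBody hA).isCompact

theorem IsConvexBody.measurableSet (hA : IsConvexBody A) : MeasurableSet A :=
  hA.isCompact.isClosed.measurableSet

/-- A point off the boundary of `dilate A x t₀` stays inside or outside when the ratio varies. -/
theorem eventually_mem_dilate_iff (hA : IsClosed A) {t₀ : ℝ} (ht : 0 < t₀)
    {y : EuclideanSpace ℝ (Fin d)} (hy : y ∉ frontier (dilate A x t₀)) :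
    ∀ᶠ t in 𝓝 t₀, (y ∈ dilate A x t ↔ y ∈ dilate A x t₀) := by
  have hc : Continuous fun z : EuclideanSpace ℝ (Fin d) => t₀⁻¹ • (z - x) + x := by fun_prop
  have hcont : ContinuousAt (fun t : ℝ => t⁻¹ • (y - x) + x) t₀ :=
    ((continuousAt_inv₀ ht.ne').smul continuousAt_const).add continuousAt_const
  by_cases h : y ∈ dilate A x t₀
  · have hi : t₀⁻¹ • (y - x) + x ∈ interior A := by
      have h1 : y ∈ interior (dilate A x t₀) := by
        by_contra h2
        exact hy ⟨subset_closure h, h2⟩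
      have hopen : IsOpenMap fun z : EuclideanSpace ℝ (Fin d) => t₀⁻¹ • (z - x) + x := by
        have := (homothetHomeomorph t₀⁻¹ (inv_ne_zero ht.ne') (x - t₀⁻¹ • x)).isOpenMap
        rw [homothetHomeomorph_coe] at this
        convert this using 2 with z
        rw [smul_sub]; abel
      rw [show dilate A x t₀ = (fun z => t₀⁻¹ • (z - x) + x) ⁻¹' A from rfl,
        ← hopen.preimage_interior_eq_interior_preimage hc] at h1
      exact h1
    filter_upwards [hcont (isOpen_interior.mem_nhds hi)] with t ht'
    exact ⟨fun _ => h, fun _ => interior_subset (s := A) ht'⟩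
  · filter_upwards [hcont (hA.isOpen_compl.mem_nhds h)] with t ht'
    exact ⟨fun h' => absurd h' ht', fun h' => absurd h' h⟩

/-- Some translate of `A` has `x` on its boundary, which is null. In dimension zero the boundary
would be empty. -/
theorem measure_singleton_eq_zero (hd : 1 ≤ d) (hA : IsConvexBody A)
    {μ : Measure (EuclideanSpace ℝ (Fin d))}
    (hμ : NonDegenerate A μ)
    (x : EuclideanSpace ℝ (Fin d)) : μ {x} = 0 := by
  have : Nonempty (Fin d) := ⟨⟨0, hd⟩⟩
  have hne : (frontier A).Nonempty := by
    rw [nonempty_iff_ne_empty, Ne, frontier_eq_empty_iff]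
    rintro (h | h)
    · simpa [h] using hA.interior_nonempty
    · exact noncompact_univ (EuclideanSpace ℝ (Fin d)) (h ▸ hA.isCompact)
  obtain ⟨q, hq⟩ := hne
  refine measure_mono_null ?_ (hμ _ (isHomothet_translate A (x - q)))
  rw [singleton_subset_iff]
  have h := (homothetHomeomorph 1 one_ne_zero (x - q)).image_frontier A
  simp only [homothetHomeomorph_coe, one_smul] at h
  rw [← h]
  exact ⟨q, hq, add_sub_cancel q x⟩

variable {μ : Measure (EuclideanSpace ℝ (Fin d))} [IsFiniteMeasureOnCompacts μ]

/-- The measure of a dilate of a convex body depends continuously on the ratio. -/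
theorem continuousAt_measure_dilate (hA : IsConvexBody A) (hμ : NonDegenerate A μ) (hx : x ∈ A)
    {t₀ : ℝ} (ht : 0 < t₀) : ContinuousAt (fun t => μ (dilate A x t)) t₀ := by
  have hm : ∀ t, MeasurableSet (dilate A x t) := fun t =>
    (show Measurable fun y : EuclideanSpace ℝ (Fin d) => t⁻¹ • (y - x) + x by fun_prop)
      hA.measurableSet
  refine tendsto_measure_of_ae_tendsto_indicator (𝓝 t₀) (hm _) hm
    (hm (2 * t₀)) (hA.isCompact_dilate x (by positivity)).measure_lt_top.ne ?_ ?_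
  · filter_upwards [eventually_gt_nhds ht, eventually_lt_nhds (show t₀ < 2 * t₀ by linarith)]
      with t h1 h2
    exact dilate_mono_right hA.convex hx h1 h2.le
  · have h0 : ∀ᵐ y ∂μ, y ∉ frontier (dilate A x t₀) := by
      rw [ae_iff]
      simpa using hμ _ (isHomothet_dilate A x ht)
    filter_upwards [h0] with y hy
    exact eventually_mem_dilate_iff hA.isCompact.isClosed ht hy

/-- As `A` is bounded, its dilates shrink to the center, which is a null set. -/
theorem tendsto_measure_dilate_zero (hd : 1 ≤ d) (hA : IsConvexBody A) (hμ : NonDegenerate A μ)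
    (hx : x ∈ A) : Tendsto (fun t => μ (dilate A x t)) (𝓝[>] 0) (𝓝 0) := by
  have hm : ∀ t, MeasurableSet (dilate A x t) := fun t =>
    (show Measurable fun y : EuclideanSpace ℝ (Fin d) => t⁻¹ • (y - x) + x by fun_prop)
      hA.measurableSet
  rw [← measure_singleton_eq_zero hd hA hμ x]
  refine tendsto_measure_of_ae_tendsto_indicator (𝓝[>] 0) (measurableSet_singleton x) hm
    (hm 1) (hA.isCompact_dilate x one_pos).measure_lt_top.ne ?_ ?_
  · filter_upwards [Ioo_mem_nhdsGT (zero_lt_one' ℝ)] with t ht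
    exact dilate_mono_right hA.convex hx ht.1 ht.2.le
  · refine Eventually.of_forall fun y => ?_
    by_cases hy : y = x
    · refine Eventually.of_forall fun t => ?_
      simp [hy, dilate, hx]
    obtain ⟨R, hR⟩ := hA.isCompact.isBounded.subset_closedBall x
    have hpos : 0 < ‖y - x‖ := norm_pos_iff.2 (sub_ne_zero.2 hy)
    have h1 : Tendsto (fun t : ℝ => t⁻¹ * ‖y - x‖) (𝓝[>] 0) atTop :=
      tendsto_inv_nhdsGT_zero.atTop_mul_const hpos
    filter_upwards [h1.eventually_gt_atTop R, self_mem_nhdsWithin] with t ht ht0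
    refine ⟨fun h => ?_, fun h => absurd h hy⟩
    have h2 := hR h
    rw [Metric.mem_closedBall, dist_eq_norm, add_sub_cancel_right, norm_smul, norm_inv,
      Real.norm_of_nonneg (le_of_lt ht0)] at h2
    exact absurd h2 (not_le.2 ht)

theorem exists_measure_dilate_eq_of_le (hA : IsConvexBody A) (hμ : NonDegenerate A μ) (hx : x ∈ A)
    {s t : ℝ} (hs : 0 < s) (hst : s ≤ t) {k : ℝ≥0∞} (h₁ : μ (dilate A x s) ≤ k)
    (h₂ : k ≤ μ (dilate A x t)) : ∃ u, s ≤ u ∧ u ≤ t ∧ μ (dilate A x u) = k := by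
  obtain ⟨u, hu, h⟩ := intermediate_value_Icc hst (f := fun t => μ (dilate A x t))
    (fun u hu => (continuousAt_measure_dilate hA hμ hx (hs.trans_le hu.1)).continuousWithinAt)
    ⟨h₁, h₂⟩
  exact ⟨u, hu.1, hu.2, h⟩

theorem exists_measure_dilate_eq (hd : 1 ≤ d) (hA : IsConvexBody A) (hμ : NonDegenerate A μ)
    (hx : x ∈ A) (ht : 0 < t) {k : ℝ≥0∞} (hk : 0 < k) (h : k ≤ μ (dilate A x t)) :
    ∃ u, 0 < u ∧ u ≤ t ∧ μ (dilate A x u) = k := by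
  obtain ⟨s, h1, h2⟩ := (((tendsto_measure_dilate_zero hd hA hμ hx).eventually_lt_const hk).and
    (Ioo_mem_nhdsGT ht)).exists
  obtain ⟨u, hu⟩ := exists_measure_dilate_eq_of_le hA hμ hx h2.1 h2.2.le h1.le h
  exact ⟨u, h2.1.trans_le hu.1, hu.2⟩

end Homothets

/-! ### Asymmetry of convex bodies and bounded overlap -/

section Geometry

open scoped Pointwise

variable {E : Type*} [NormedAddCommGroup E] [NormedSpace ℝ E] [FiniteDimensional ℝ E]

/-- Every compact convex set has a point about which its asymmetry is at most the dimension. -/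
theorem exists_center {C : Set E} (hC : Convex ℝ C) (hcomp : IsCompact C) (hne : C.Nonempty)
    (hd : 1 ≤ Module.finrank ℝ E) :
    ∃ c, ∀ x ∈ C, c - (Module.finrank ℝ E : ℝ)⁻¹ • (x - c) ∈ C := by
  classical
  set n := Module.finrank ℝ E with hn
  have hn0 : (0 : ℝ) < n := by exact_mod_cast hd
  set a : ℝ := n / (n + 1) with ha
  set b : ℝ := 1 / (n + 1) with hb
  have hkey : ∀ (x c : E), c ∈ (fun y => a • y + b • x) '' C → c - (n : ℝ)⁻¹ • (x - c) ∈ C := by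
    rintro x _ ⟨y, hy, rfl⟩
    convert hy using 1
    simp only [ha, hb]
    match_scalars <;> field_simp <;> ring
  obtain ⟨x₀, hx₀⟩ := hne
  have : Nonempty C := ⟨⟨x₀, hx₀⟩⟩
  have hhelly : (⋂ x : C, (fun y => a • y + b • (x : E)) '' C).Nonempty := by
    refine Convex.helly_theorem_compact' (𝕜 := ℝ) (fun x => ?_) (fun x => ?_) fun I hI => ?_
    · have : (fun y => a • y + b • (x : E)) '' C = (fun c => c + b • (x : E)) '' ((a • ·) '' C) := by
        rw [image_image]
      rw [this]
      simpa [add_comm, ← image_smul] using (hC.smul a).translate (b • (x : E))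
    · exact hcomp.image (by fun_prop)
    · rw [← hn] at hI
      -- The common point is the centroid of the points of `I`, padded with copies of `x₀` to `n +
      -- 1` points.
      refine ⟨b • ∑ i ∈ I, (i : E) + (1 - b * I.card) • x₀, ?_⟩
      simp only [mem_iInter]
      intro i hi
      refine ⟨(n : ℝ)⁻¹ • (∑ j ∈ I.erase i, (j : E) + ((n : ℝ) + 1 - I.card) • x₀), ?_, ?_⟩
      · have hcard : ((I.erase i).card : ℝ) = I.card - 1 := by
          rw [Finset.card_erase_of_mem hi, Nat.cast_sub (Finset.card_pos.2 ⟨i, hi⟩), Nat.cast_one]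
        have hle : (I.card : ℝ) ≤ n + 1 := by exact_mod_cast hI
        have hpos : (1 : ℝ) ≤ I.card := by exact_mod_cast Finset.card_pos.2 ⟨i, hi⟩
        have hmem : ∀ J : Finset C, ∀ r : ℝ, 0 ≤ r → 0 < J.card + r →
            (J.card + r)⁻¹ • (∑ j ∈ J, (j : E) + r • x₀) ∈ C := by
          intro J r hr hJ
          rcases J.eq_empty_or_nonempty with rfl | hJn
          · simp only [Finset.card_empty, Nat.cast_zero, zero_add] at hJ
            simpa [inv_smul_smul₀ hJ.ne'] using hx₀
          have hJc : (0 : ℝ) < J.card := by exact_mod_cast hJn.card_pos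
          have h1 : ∑ j ∈ J, (J.card : ℝ)⁻¹ • (j : E) ∈ C :=
            hC.sum_mem (fun _ _ => by positivity) (by simp [hJc.ne']) fun j _ => j.2
          have h2 := hC h1 hx₀ (a := J.card / (J.card + r)) (b := r / (J.card + r))
            (by positivity) (by positivity) (by field_simp)
          convert h2 using 1
          rw [← Finset.smul_sum]
          match_scalars <;> field_simp
        have := hmem (I.erase i) (n + 1 - I.card) (by linarith) (by rw [hcard]; linarith)
        rwa [hcard, show (I.card : ℝ) - 1 + (n + 1 - I.card) = n by ring] at this
      · simp only [ha, hb]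
        rw [← Finset.add_sum_erase I (fun j : C => (j : E)) hi]
        match_scalars <;> field_simp
  obtain ⟨c, hc⟩ := hhelly
  exact ⟨c, fun x hx => hkey x c (mem_iInter.1 hc ⟨x, hx⟩)⟩

/-- A volume bound for the number of separated points in a multiple of a symmetric body. -/
theorem card_le_of_separated {B : Set E} (hB : Convex ℝ B) (hcomp : IsCompact B)
    (hsymm : ∀ x ∈ B, -x ∈ B) (hint : (interior B).Nonempty) {R : ℝ} (hR : 0 ≤ R)
    {ι : Type*} (s : Finset ι) (q : ι → E) (hq : ∀ i ∈ s, q i ∈ R • B)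
    (hsep : ∀ i ∈ s, ∀ j ∈ s, i ≠ j → q i - q j ∉ (1 / 2 : ℝ) • B) :
    (s.card : ℝ) ≤ (4 * R + 1) ^ Module.finrank ℝ E := by
  let : MeasurableSpace E := borel E
  have : BorelSpace E := ⟨rfl⟩
  let v : Measure E := Measure.addHaar
  set n := Module.finrank ℝ E
  have hB0 : v B ≠ 0 := by
    refine ((isOpen_interior.measure_pos v hint).trans_le (measure_mono interior_subset)).ne'
  have hBt : v B ≠ ∞ := hcomp.measure_lt_top.ne
  have hmeas : ∀ i ∈ s, MeasurableSet (q i +ᵥ (1 / 4 : ℝ) • B) := fun i _ =>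
    ((hcomp.smul (1 / 4 : ℝ)).vadd (q i)).isClosed.measurableSet
  have hdisj : (s : Set ι).PairwiseDisjoint fun i => q i +ᵥ (1 / 4 : ℝ) • B := by
    intro i hi j hj hij
    refine Set.disjoint_left.2 ?_
    rintro y ⟨_, ⟨b, hb, rfl⟩, rfl⟩ ⟨_, ⟨b', hb', rfl⟩, hy⟩
    refine hsep i hi j hj hij ⟨(1 / 2 : ℝ) • b' + (1 / 2 : ℝ) • (-b),
      hB hb' (hsymm b hb) (by norm_num) (by norm_num) (by norm_num), ?_⟩
    simp only [vadd_eq_add] at hy ⊢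
    have : q i - q j = (1 / 4 : ℝ) • b' - (1 / 4 : ℝ) • b := by
      rw [sub_eq_sub_iff_add_eq_add, ← hy]; abel
    rw [this]
    match_scalars <;> norm_num
  have hsub : (⋃ i ∈ s, (q i +ᵥ (1 / 4 : ℝ) • B)) ⊆ (R + 1 / 4) • B := by
    rw [hB.add_smul hR (by norm_num)]
    refine iUnion₂_subset fun i hi => ?_
    rintro _ ⟨b, hb, rfl⟩
    exact add_mem_add (hq i hi) hb
  have h1 := measure_mono (μ := v) hsub
  rw [measure_biUnion_finset hdisj hmeas] at h1
  simp only [measure_vadd, Measure.addHaar_smul, Finset.sum_const, nsmul_eq_mul] at h1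
  rw [← mul_assoc, ENNReal.mul_le_mul_iff_left hB0 hBt, ← ENNReal.ofReal_natCast,
    ← ENNReal.ofReal_mul (by positivity), ENNReal.ofReal_le_ofReal_iff (by positivity),
    abs_of_nonneg (by positivity), abs_of_nonneg (by positivity)] at h1
  calc (s.card : ℝ) = s.card * (1 / 4) ^ n * 4 ^ n := by
        rw [mul_assoc, ← mul_pow]; norm_num
    _ ≤ (R + 1 / 4) ^ n * 4 ^ n := by gcongr
    _ = (4 * R + 1) ^ n := by rw [← mul_pow]; ring

/-- Homothets of a body of bounded asymmetry, of roughly decreasing sizes and such that none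
contains the center of a later one, cover each point a bounded number of times. -/
theorem card_le_of_centers_not_mem {D : Set E} (hD : Convex ℝ D) (hcomp : IsCompact D)
    (h0 : 0 ∈ interior D) {a : ℝ} (ha : 1 ≤ a) (hasymm : ∀ x ∈ D, -(a⁻¹ • x) ∈ D)
    (p : ℕ → E) (l : ℕ → ℝ) (z : E) (s : Finset ℕ) (hl : ∀ i ∈ s, 0 < l i)
    (hlij : ∀ i ∈ s, ∀ j ∈ s, i < j → l j ≤ (1 + 1 / (2 * a)) * l i)
    (hp : ∀ i ∈ s, ∀ j ∈ s, i < j → (l i)⁻¹ • (p j - p i) ∉ D)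
    (hz : ∀ i ∈ s, (l i)⁻¹ • (z - p i) ∈ D) :
    (s.card : ℝ) ≤ (4 * a + 1) ^ Module.finrank ℝ E := by
  have ha0 : 0 < a := one_pos.trans_le ha
  have h0D : (0 : E) ∈ D := interior_subset h0
  -- The symmetric core of `D`; bounded asymmetry gives `D ⊆ a • B`. The centers, seen from `z` and
  -- rescaled by their own ratios, will be separated points of `a • B`.
  set B := D ∩ -D with hBdef
  have hBc : Convex ℝ B := hD.inter hD.neg
  have hsymm : ∀ x ∈ B, -x ∈ B := fun x hx => ⟨hx.2, by simpa using hx.1⟩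
  have hDB : ∀ x ∈ D, a⁻¹ • x ∈ B := fun x hx => by
    refine ⟨?_, hasymm x hx⟩
    exact hD.smul_mem_of_zero_mem h0D hx ⟨by positivity, inv_le_one_of_one_le₀ ha⟩
  have hq : ∀ i ∈ s, (l i)⁻¹ • (p i - z) ∈ a • B := by
    intro i hi
    refine ⟨a⁻¹ • (l i)⁻¹ • (p i - z), ?_, by simp [smul_inv_smul₀ ha0.ne']⟩
    have := hsymm _ (hDB _ (hz i hi))
    rwa [← smul_neg, ← smul_neg, neg_sub] at this
  have hlt : ∀ i ∈ s, ∀ j ∈ s, i < j →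
      (l i)⁻¹ • (p i - z) - (l j)⁻¹ • (p j - z) ∉ (1 / 2 : ℝ) • B := by
    rintro i hi j hj hij ⟨b, hb, hbe⟩
    obtain ⟨b', hb', hbe'⟩ := hq j hj
    have hli := hl i hi
    have hlj := hl j hj
    set e : ℝ := 1 + 1 / (2 * a) with he
    have he0 : 0 < e := by positivity
    refine hp i hi j hj hij ?_
    have h1 : (1 / 2 : ℝ) • (-b) + (1 / 2 : ℝ) • b' ∈ D :=
      hD (hsymm b hb).1 hb'.1 (by norm_num) (by norm_num) (by norm_num)
    have h2 := hD h1 (hz i hi) (a := l j / l i / e) (b := 1 - l j / l i / e) (by positivity)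
      (by rw [sub_nonneg, div_le_one he0, div_le_iff₀ hli]; exact hlij i hi j hj hij) (by ring)
    -- Write `qᵢ = (pᵢ - z) / lᵢ`. If `qᵢ - qⱼ` were in `B / 2`, then `e qⱼ - qᵢ` would be in `D`,
    -- since the excess `qⱼ / (2a)` is also in `B / 2`. As `lⱼ ≤ e lᵢ`, the point `(pⱼ - pᵢ) / lᵢ`
    -- is a convex combination of `e qⱼ - qᵢ` and `-qᵢ`, hence in `D`, a contradiction.
    have h3 : (1 / 2 : ℝ) • (-b) + (1 / 2 : ℝ) • b'
        = e • (l j)⁻¹ • (p j - z) - (l i)⁻¹ • (p i - z) := by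
      simp only at hbe hbe'
      have hb2 : (1 / 2 : ℝ) • b' = (1 / (2 * a)) • (l j)⁻¹ • (p j - z) := by
        rw [← hbe', smul_smul]
        congr 1
        field_simp
      rw [hb2, smul_neg, hbe, he, add_smul, one_smul]
      abel
    rw [h3] at h2
    convert h2 using 1
    clear h3 h2 h1 hbe hbe'
    have := he0.ne'
    clear_value e
    match_scalars <;> field_simp <;> ring
  refine card_le_of_separated hBc (hcomp.inter_right hcomp.neg.isClosed) hsymm ⟨0, ?_⟩ ha0.le s
    (fun i => (l i)⁻¹ • (p i - z)) hq fun i hi j hj hij => ?_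
  · rw [hBdef, interior_inter]
    refine ⟨h0, ?_⟩
    have := (Homeomorph.neg E).preimage_interior D
    simp only [Homeomorph.coe_neg] at this
    change (0 : E) ∈ interior (Neg.neg ⁻¹' D)
    rw [← this]
    simpa using h0
  · rcases lt_or_gt_of_ne hij with h | h
    · exact hlt i hi j hj h
    · rintro ⟨b, hb, hbe⟩
      refine hlt j hj i hi h ⟨-b, hsymm b hb, ?_⟩
      simp only [smul_neg] at hbe ⊢
      rw [hbe, neg_sub]

end Geometry

/-! ### Greedy selection and the covering bound -/

/-- A greedy selection either covers `K` with the chosen sets, or goes on. -/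
theorem exists_cover_or_exists_greedy {E : Type*} (K : Set E) (A : E → Set E) (l : E → ℝ)
    {Λ : ℝ} (hl : ∀ x ∈ K, 0 < l x) (hΛ : ∀ x ∈ K, l x ≤ Λ) {e : ℝ} (he : 1 < e) (n : ℕ) :
    (∃ s : Finset E, s.card ≤ n ∧ ↑s ⊆ K ∧ K ⊆ ⋃ x ∈ s, A x) ∨
    ∃ p : ℕ → E, (∀ i < n, p i ∈ K) ∧ (∀ j < n, ∀ i < j, p j ∉ A (p i)) ∧
      ∀ i < n, ∀ x ∈ K, (∀ j < i, x ∉ A (p j)) → l x ≤ e * l (p i) := by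
  classical
  rcases K.eq_empty_or_nonempty with rfl | ⟨x₀, -⟩
  · exact Or.inl ⟨∅, by simp⟩
  induction n with
  | zero => exact Or.inr ⟨fun _ => x₀, by simp⟩
  | succ n ih =>
    rcases ih with ⟨s, hs, h⟩ | ⟨p, hpK, hpA, hpl⟩
    · exact Or.inl ⟨s, hs.trans n.le_succ, h⟩
    set U := {x | x ∈ K ∧ ∀ i < n, x ∉ A (p i)} with hU
    rcases U.eq_empty_or_nonempty with hU0 | hUn
    · refine Or.inl ⟨(Finset.range n).image p, Finset.card_image_le.trans (by simp), ?_, ?_⟩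
      · intro x hx
        obtain ⟨i, hi, rfl⟩ := Finset.mem_image.1 hx
        exact hpK i (Finset.mem_range.1 hi)
      · intro x hx
        by_contra hcon
        have : x ∈ U := by
          refine ⟨hx, fun i hi hxi => hcon ?_⟩
          simp only [mem_iUnion]
          exact ⟨p i, Finset.mem_image_of_mem p (Finset.mem_range.2 hi), hxi⟩
        simp [hU0] at this
    · have hbdd : BddAbove (l '' U) := ⟨Λ, by rintro _ ⟨x, hx, rfl⟩; exact hΛ x hx.1⟩
      have hpos : 0 < sSup (l '' U) := by
        obtain ⟨x, hx⟩ := hUn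
        exact (hl x hx.1).trans_le (le_csSup hbdd (mem_image_of_mem l hx))
      have he0 : 0 < e := one_pos.trans he
      -- The supremum need not be attained, hence the loss of a factor `e > 1`.
      obtain ⟨_, ⟨y, hy, rfl⟩, hlt⟩ := exists_lt_of_lt_csSup (hUn.image l)
        (show sSup (l '' U) / e < sSup (l '' U) from div_lt_self hpos he)
      rw [div_lt_iff₀ he0, mul_comm] at hlt
      have hup : ∀ i < n, Function.update p n y i = p i := fun i hi =>
        Function.update_of_ne hi.ne _ _
      refine Or.inr ⟨Function.update p n y, fun i hi => ?_, fun j hj i hij => ?_,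
        fun i hi x hx hxj => ?_⟩
      · rcases Nat.lt_succ_iff_lt_or_eq.1 hi with h | rfl
        · rw [hup i h]; exact hpK i h
        · simpa using hy.1
      · rcases Nat.lt_succ_iff_lt_or_eq.1 hj with h | rfl
        · rw [hup j h, hup i (hij.trans h)]; exact hpA j h i hij
        · rw [hup i hij]; simpa using hy.2 i hij
      · rcases Nat.lt_succ_iff_lt_or_eq.1 hi with h | rfl
        · rw [hup i h]
          exact hpl i h x hx fun j hj => by rw [← hup j (hj.trans h)]; exact hxj j hj
        · simp only [Function.update_self]
          refine (le_csSup hbdd (mem_image_of_mem l ⟨hx, fun j hj => ?_⟩)).trans hlt.le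
          rw [← hup j hj]; exact hxj j hj

/-- If each point lies in at most `M` of the sets, their measures add up to at most `M μ(univ)`. -/
theorem sum_measure_le_of_card_filter_le {α ι : Type*} [MeasurableSpace α] (μ : Measure α)
    (s : Finset ι) (A : ι → Set α) (hA : ∀ i ∈ s, MeasurableSet (A i)) (M : ℕ)
    (hM : ∀ z, ∀ t ⊆ s, (∀ i ∈ t, z ∈ A i) → t.card ≤ M) :
    ∑ i ∈ s, μ (A i) ≤ M * μ univ := by
  classical
  calc ∑ i ∈ s, μ (A i) = ∑ i ∈ s, ∫⁻ z, (A i).indicator 1 z ∂μ :=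
        Finset.sum_congr rfl fun i hi => (lintegral_indicator_one (hA i hi)).symm
    _ = ∫⁻ z, ∑ i ∈ s, (A i).indicator 1 z ∂μ :=
        (lintegral_finsetSum' _ fun i hi =>
          (measurable_one.indicator (hA i hi)).aemeasurable).symm
    _ ≤ ∫⁻ _, (M : ℝ≥0∞) ∂μ := by
        refine lintegral_mono fun z => ?_
        have : ∑ i ∈ s, (A i).indicator (1 : α → ℝ≥0∞) z = ((s.filter (z ∈ A ·)).card : ℝ≥0∞) := by
          simp [indicator_apply, Finset.sum_boole]
        simp only
        rw [this]
        exact_mod_cast hM z _ (Finset.filter_subset _ _) fun i hi => (Finset.mem_filter.1 hi).2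
    _ = M * μ univ := by simp

/-- The overlap bound with `a = d` gives `(4d + 1) ^ d`; the extra 1 pays for rounding up. -/
theorem isCoverBound_natCast {d : ℕ} (hd : 1 ≤ d) :
    IsCoverBound d (((4 * d + 1) ^ d + 1 : ℕ) : ℝ≥0∞) := by
  classical
  intro C μ x r k hC hfin hμ hr hball hk hkμ
  set M := (4 * d + 1) ^ d with hMdef
  have : IsFiniteMeasure μ := ⟨hfin⟩
  have hd0 : (0 : ℝ) < d := by exact_mod_cast hd
  have hfr : Module.finrank ℝ (EuclideanSpace ℝ (Fin d)) = d := finrank_euclideanSpace_fin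
  obtain ⟨c, hc⟩ := exists_center hC.convex hC.isCompact
    (hC.interior_nonempty.mono interior_subset) (by rw [hfr]; exact hd)
  rw [hfr] at hc
  have hcint : c ∈ interior C := by
    obtain ⟨y, hy⟩ := hC.interior_nonempty
    -- `c` lies between an interior point and the contracted reflection of that point through `c`.
    have := hC.convex.combo_interior_self_mem_interior hy (hc y (interior_subset hy))
      (a := 1 / (d + 1)) (b := d / (d + 1)) (by positivity) (by positivity) (by field_simp; ring)
    convert this using 1
    match_scalars <;> field_simp <;> ring
  obtain ⟨ρ, hρ, hρC⟩ := Metric.mem_nhds_iff.1 (mem_interior_iff_mem_nhds.1 hcint)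
  set D : Set (EuclideanSpace ℝ (Fin d)) := (fun y => y + (0 - c)) '' C with hDdef
  set T : EuclideanSpace ℝ (Fin d) → Set (EuclideanSpace ℝ (Fin d)) :=
    fun p => (fun y => y + (p - c)) '' C with hT
  have hThom : ∀ p, IsHomothet C (T p) := fun p => isHomothet_translate C _
  have hmemT : ∀ p w, w ∈ T p ↔ w - (p - c) ∈ C := fun p w => by
    simp only [hT, mem_image]
    exact ⟨by rintro ⟨y, hy, rfl⟩; simpa using hy, fun h => ⟨_, h, by abel⟩⟩
  have hmemD : ∀ w, w ∈ D ↔ w + c ∈ C := fun w => by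
    rw [show D = T 0 from rfl, hmemT]; simp
  have hTball : ∀ p, Metric.ball p ρ ⊆ T p := fun p w hw => by
    rw [hmemT]
    apply hρC
    rw [Metric.mem_ball, dist_eq_norm] at hw ⊢
    convert hw using 2
    abel
  have hpT : ∀ p, p ∈ T p := fun p => hTball p (Metric.mem_ball_self hρ)
  -- At ratio `2 * r / ρ` the dilate contains the whole ball. This also bounds the ratios uniformly,
  -- as the greedy selection requires.
  have hsize : ∀ p ∈ Metric.ball x r, ∃ u, 0 < u ∧ u ≤ 2 * r / ρ ∧ μ (dilate (T p) p u) = k := by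
    intro p hp
    refine exists_measure_dilate_eq hd ((hThom p).isConvexBody hC) (hμ.of_isHomothet (hThom p))
      (hpT p) (by positivity) (by exact_mod_cast hk) (hkμ.trans ?_)
    rw [← hball]
    refine measure_mono (Subset.trans ?_ (ball_subset_dilate (hTball p) (by positivity)))
    intro y hy
    rw [div_mul_cancel₀ _ hρ.ne', two_mul]
    rw [Metric.mem_ball] at hp hy ⊢
    exact (dist_triangle_right y p x).trans_lt (add_lt_add hy hp)
  choose! l hl0 hlΛ hlk using hsize
  set A : EuclideanSpace ℝ (Fin d) → Set (EuclideanSpace ℝ (Fin d)) :=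
    fun p => dilate (T p) p (l p) with hA
  have hAhom : ∀ p ∈ Metric.ball x r, IsHomothet C (A p) := fun p hp =>
    (hThom p).trans (isHomothet_dilate _ _ (hl0 p hp))
  have hmemA : ∀ p y, y ∈ A p ↔ (l p)⁻¹ • (y - p) ∈ D := fun p y => by
    rw [hmemD, hA]
    simp only [dilate, mem_ofPred_eq]
    rw [hmemT]
    congr! 1
    abel
  set N := ⌊M * (μ univ).toReal / k⌋₊ with hN
  have hk0 : (0 : ℝ) < k := by exact_mod_cast hk
  rcases exists_cover_or_exists_greedy (Metric.ball x r) A l hl0 hlΛ (e := 1 + 1 / (2 * d))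
    (by simp [hd0]) (N + 1) with ⟨s, hs, hsK, hcov⟩ | ⟨p, hpK, hpA, hpl⟩
  swap
  -- `N + 1` sets of measure `k` would have total measure above `M * μ univ`.
  · exfalso
    have hle := sum_measure_le_of_card_filter_le μ (Finset.range (N + 1)) (fun i => A (p i))
      (fun i hi => ((hAhom _ (hpK i (Finset.mem_range.1 hi))).isConvexBody hC).measurableSet) M ?_
    · rw [Finset.sum_congr rfl fun i hi => hlk _ (hpK i (Finset.mem_range.1 hi))] at hle
      have h1 := ENNReal.toReal_mono (ENNReal.mul_ne_top (by simp) hfin.ne) hle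
      simp only [Finset.sum_const, Finset.card_range, nsmul_eq_mul, ENNReal.toReal_mul,
        ENNReal.toReal_natCast, ENNReal.coe_toReal] at h1
      have h2 := Nat.lt_floor_add_one (M * (μ univ).toReal / k)
      rw [div_lt_iff₀ hk0, ← hN] at h2
      push_cast at h1
      linarith
    · intro z t ht hz
      have hlt : ∀ i ∈ t, i < N + 1 := fun i hi => Finset.mem_range.1 (ht hi)
      have := card_le_of_centers_not_mem (D := D) (a := d)
        ((isHomothet_translate C (0 - c)).isConvexBody hC).convex
        ((isHomothet_translate C (0 - c)).isConvexBody hC).isCompact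
        (mem_interior_iff_mem_nhds.2 (Metric.mem_nhds_iff.2 ⟨ρ, hρ, hTball 0⟩))
        (by exact_mod_cast hd) ?_ p (fun i => l (p i)) z t
        (fun i hi => hl0 _ (hpK i (hlt i hi))) ?_ ?_ ?_
      · rw [hfr] at this
        exact_mod_cast this
      · intro y hy
        rw [hmemD] at hy ⊢
        convert hc _ hy using 1
        rw [add_sub_cancel_right]
        abel
      · intro i hi j hj hij
        exact hpl i (hlt i hi) _ (hpK j (hlt j hj)) fun m hm =>
          hpA j (hlt j hj) m (hm.trans hij)
      · intro i hi j hj hij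
        rw [← hmemA]
        exact hpA j (hlt j hj) i hij
      · intro i hi
        rw [← hmemA]
        exact hz i hi
  · have hcn : coverNumber C k μ (Metric.ball x r) ≤ N + 1 := by
      refine iInf₂_le_of_le (↑(s.image A)) ⟨?_, ?_⟩ ?_
      · intro B hB
        obtain ⟨p, hp, rfl⟩ := Finset.mem_image.1 hB
        exact ⟨hAhom p (hsK hp), (hlk p (hsK hp)).le⟩
      · intro y hy
        obtain ⟨p, hp, hyp⟩ := mem_iUnion₂.1 (hcov hy)
        exact ⟨A p, Finset.mem_image_of_mem A hp, hyp⟩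
      · rw [encard_coe_eq_coe_finsetCard]
        exact_mod_cast Finset.card_image_le.trans hs
    have hN1 : (N : ℝ≥0∞) ≤ M * (μ univ / k) := by
      have h := Nat.floor_le (show 0 ≤ M * (μ univ).toReal / k by positivity)
      rw [← ENNReal.toReal_le_toReal (by simp) (ENNReal.mul_ne_top (by simp)
        (ENNReal.div_ne_top hfin.ne (by simpa using hk.ne')))]
      simpa [hN, mul_div_assoc] using h
    have h1 : (1 : ℝ≥0∞) ≤ μ univ / k := by
      rw [ENNReal.le_div_iff_mul_le (by simp [hk.ne']) (by simp), one_mul]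
      exact hkμ
    calc (coverNumber C k μ (Metric.ball x r) : ℝ≥0∞) ≤ ((N + 1 : ℕ∞) : ℝ≥0∞) :=
          ENat.toENNReal_le.2 hcn
      _ = N + 1 := by simp
      _ ≤ M * (μ univ / k) + μ univ / k := add_le_add hN1 h1
      _ = ((M + 1 : ℕ) : ℝ≥0∞) * (μ univ / k) := by push_cast; ring

/-! ### Gluing finite covers into a covering of low density -/

section Density

variable {d : ℕ} {C A : Set (EuclideanSpace ℝ (Fin d))}
  {μ : Measure (EuclideanSpace ℝ (Fin d))}

/-- A density bound for a covering that is built ball by ball. -/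
theorem homothetyCoveringDensity_le_of_forall_exists {a : ℝ≥0∞}
    (h : ∀ (r : ℝ) (S : Set (Set (EuclideanSpace ℝ (Fin d)))), S.Finite →
      ∃ (r' : ℝ) (G : Set (Set (EuclideanSpace ℝ (Fin d)))), r + 1 ≤ r' ∧ G.Finite ∧
      (∀ B ∈ G, IsHomothet C B ∧ μ B = μ C) ∧ Metric.ball 0 r' ⊆ ⋃₀ G ∧
      ((S.encard : ℝ≥0∞) + ({B ∈ G | B ⊆ Metric.ball 0 r'}.encard : ℕ∞)) * μ C
        ≤ a * μ (Metric.ball 0 r')) :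
    homothetyCoveringDensity μ C ≤ a := by
  choose! R G hR hG hGC hGcov hGle using h
  -- A new set inside the previous ball is dropped: it covers nothing outside that ball, and the
  -- ball is already covered.
  let X : ℕ → ℝ × Set (Set (EuclideanSpace ℝ (Fin d))) := fun n =>
    Nat.rec (0, ∅) (fun _ Y => (R Y.1 Y.2, Y.2 ∪ {B ∈ G Y.1 Y.2 | ¬ B ⊆ Metric.ball 0 Y.1})) n
  let ρ : ℕ → ℝ := fun n => (X n).1
  let S : ℕ → Set (Set (EuclideanSpace ℝ (Fin d))) := fun n => (X n).2
  have hρ : ∀ n, ρ (n + 1) = R (ρ n) (S n) := fun _ => rfl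
  have hS : ∀ n, S (n + 1) = S n ∪ {B ∈ G (ρ n) (S n) | ¬ B ⊆ Metric.ball 0 (ρ n)} := fun _ => rfl
  have hS0 : S 0 = ∅ := rfl
  have hρ0 : ρ 0 = 0 := rfl
  have hSf : ∀ n, (S n).Finite := by
    intro n
    induction n with
    | zero => exact finite_empty
    | succ n ih => rw [hS]; exact ih.union ((hG _ _ ih).subset (sep_subset _ _))
  have hρn : ∀ n : ℕ, (n : ℝ) ≤ ρ n := by
    intro n
    induction n with
    | zero => simp [hρ0]
    | succ n ih => rw [hρ]; push_cast; linarith [hR (ρ n) (S n) (hSf n)]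
  have hρmono : Monotone ρ := monotone_nat_of_le_succ fun n => by
    rw [hρ]; linarith [hR (ρ n) (S n) (hSf n)]
  have hSmono : Monotone S := monotone_nat_of_le_succ fun n => by
    rw [hS]; exact subset_union_left
  have hScov : ∀ n, Metric.ball 0 (ρ n) ⊆ ⋃₀ S n := by
    intro n
    induction n with
    | zero => simp [hρ0]
    | succ n ih =>
      intro y hy
      by_cases hyn : y ∈ Metric.ball 0 (ρ n)
      · obtain ⟨B, hB, hyB⟩ := ih hyn
        exact ⟨B, hSmono n.le_succ hB, hyB⟩
      · rw [hρ] at hy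
        obtain ⟨B, hB, hyB⟩ := hGcov (ρ n) (S n) (hSf n) hy
        exact ⟨B, by rw [hS]; exact Or.inr ⟨hB, fun hsub => hyn (hsub hyB)⟩, hyB⟩
  have hShom : ∀ n, ∀ B ∈ S n, IsHomothet C B ∧ μ B = μ C := by
    intro n
    induction n with
    | zero => simp [hS0]
    | succ n ih =>
      rw [hS]
      rintro B (hB | hB)
      · exact ih B hB
      · exact hGC _ _ (hSf n) B hB.1
  -- Later stages add no set inside an earlier ball, so the count in a ball is settled at its own
  -- stage.
  have hback : ∀ n m, n ≤ m → ∀ B ∈ S m, B ⊆ Metric.ball 0 (ρ n) → B ∈ S n := by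
    intro n m hnm
    induction m, hnm using Nat.le_induction with
    | base => exact fun B hB _ => hB
    | succ m hnm ih =>
      intro B hB hsub
      rw [hS] at hB
      rcases hB with hB | hB
      · exact ih B hB hsub
      · exact absurd (hsub.trans (Metric.ball_subset_ball (hρmono hnm))) hB.2
  refine iInf₂_le_of_le (⋃ n, S n) ⟨fun B hB => ?_, ?_⟩ ?_
  · obtain ⟨n, hn⟩ := mem_iUnion.1 hB
    exact hShom n B hn
  · refine eq_univ_of_forall fun y => ?_
    obtain ⟨n, hn⟩ := exists_nat_gt (dist y 0)
    obtain ⟨B, hB, hyB⟩ := hScov n (Metric.mem_ball.2 (hn.trans_le (hρn n)))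
    exact ⟨B, mem_iUnion.2 ⟨n, hB⟩, hyB⟩
  · refine liminf_le_of_frequently_le' (frequently_atTop.2 fun b => ?_)
    obtain ⟨n, hn⟩ := exists_nat_ge b
    refine ⟨ρ (n + 1), hn.trans ((hρn n).trans (hρmono n.le_succ)), ?_⟩
    refine ENNReal.div_le_of_le_mul ?_
    have hmem : ∀ B : {B // B ∈ ⋃ n, S n ∧ B ⊆ Metric.ball 0 (ρ (n + 1))}, μ B.1 = μ C := fun B => by
      obtain ⟨m, hm⟩ := mem_iUnion.1 B.2.1
      exact (hShom m _ hm).2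
    rw [tsum_congr hmem, ENNReal.tsum_const]
    refine le_trans ?_ (hGle (ρ n) (S n) (hSf n))
    refine mul_le_mul_left ?_ _
    rw [← ENat.toENNReal_add, ENat.toENNReal_le]
    refine le_trans (encard_le_encard (t := S n ∪ {B ∈ G (ρ n) (S n) | B ⊆ Metric.ball 0 (ρ (n + 1))})
      ?_) (encard_union_le _ _)
    rintro B ⟨hB, hsub⟩
    obtain ⟨m, hm⟩ := mem_iUnion.1 hB
    have hB' : B ∈ S (n + 1) := by
      rcases le_total (n + 1) m with h | h
      · exact hback _ _ h B hm hsub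
      · exact hSmono h hm
    rw [hS] at hB'
    rcases hB' with h | h
    · exact Or.inl h
    · exact Or.inr ⟨h.1, hsub⟩

variable [IsFiniteMeasureOnCompacts μ]

theorem tendsto_measure_ball_atTop (μ : Measure (EuclideanSpace ℝ (Fin d)))
    (x : EuclideanSpace ℝ (Fin d)) :
    Tendsto (fun r : ℝ => μ (Metric.ball x r)) atTop (𝓝 (μ univ)) := by
  have h := tendsto_measure_iUnion_atTop (μ := μ) (s := fun r : ℝ => Metric.ball x r)
    fun r s hrs => Metric.ball_subset_ball hrs
  rwa [show (⋃ r : ℝ, Metric.ball x r) = univ from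
    eq_univ_of_forall fun y => mem_iUnion.2 ⟨dist y x + 1, by simp⟩] at h

/-- A homothet whose part in a ball has measure less than `k` is covered by finitely many homothets
of measure exactly `k`, at most one of which is contained in the ball. -/
theorem exists_finite_cover_measure_eq (hd : 1 ≤ d) (hA : IsConvexBody A) (hμ : NonDegenerate A μ)
    (hinf : μ univ = ∞) {k : ℝ≥0∞} (hk : k ≠ ∞) (r : ℝ) (h : μ (A ∩ Metric.ball 0 r) < k) :
    ∃ (A₀ : Set (EuclideanSpace ℝ (Fin d))) (H : Set (Set (EuclideanSpace ℝ (Fin d)))),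
      H.Finite ∧ (IsHomothet A A₀ ∧ μ A₀ = k) ∧
      (∀ B ∈ H, (IsHomothet A B ∧ μ B = k) ∧ ¬ B ⊆ Metric.ball 0 r) ∧ A ⊆ A₀ ∪ ⋃₀ H := by
  have hk0 : 0 < k := zero_le.trans_lt h
  obtain ⟨x₀, hx₀⟩ := hA.interior_nonempty
  have hx₀A := interior_subset hx₀
  rcases le_or_gt (μ A) k with hle | hlt
  · obtain ⟨ρ, hρ, hρA⟩ := Metric.mem_nhds_iff.1 (mem_interior_iff_mem_nhds.1 hx₀)
    have hT := (tendsto_measure_ball_atTop μ x₀).eventually_const_lt (hinf ▸ hk.lt_top : k < μ univ)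
    obtain ⟨R, hR, hR1⟩ := (hT.and (eventually_ge_atTop ρ)).exists
    obtain ⟨u, hu1, -, hu⟩ := exists_measure_dilate_eq_of_le hA hμ hx₀A one_pos
      (t := R / ρ) (by rwa [le_div_iff₀ hρ, one_mul]) (k := k) (by rwa [dilate_one]) (by
        refine hR.le.trans (measure_mono ?_)
        have := ball_subset_dilate hρA (t := R / ρ) (div_pos (hρ.trans_le hR1) hρ)
        rwa [div_mul_cancel₀ _ hρ.ne'] at this)
    refine ⟨_, ∅, finite_empty, ⟨isHomothet_dilate A x₀ (one_pos.trans_le hu1), hu⟩, by simp, ?_⟩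
    have := dilate_mono_right hA.convex hx₀A one_pos hu1
    rw [dilate_one] at this
    exact this.trans subset_union_left
  · obtain ⟨u₀, hu₀, -, hu₀k⟩ := exists_measure_dilate_eq hd hA hμ hx₀A one_pos hk0
      (by rw [dilate_one]; exact hlt.le)
    -- The slight enlargement `A'` makes every point of `A` interior, so dilates of `A'` about such
    -- points are neighborhoods of them and compactness applies.
    have hcont := continuousAt_measure_dilate hA (hμ.restrict (Metric.ball 0 r)) hx₀A one_pos
    have hev : ∀ᶠ t in 𝓝[>] (1 : ℝ), μ.restrict (Metric.ball 0 r) (dilate A x₀ t) < k := by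
      refine (hcont.eventually_lt_const ?_).filter_mono nhdsWithin_le_nhds
      rwa [show (fun t => μ.restrict (Metric.ball 0 r) (dilate A x₀ t)) 1 = _ from
        congrArg _ (dilate_one A x₀), Measure.restrict_apply hA.measurableSet]
    obtain ⟨s, hs, hs1⟩ := (hev.and self_mem_nhdsWithin).exists
    have hs0 : 0 < s := one_pos.trans hs1
    set A' := dilate A x₀ s with hA'
    have hAA' : A ⊆ interior A' := subset_interior_dilate hA.convex hx₀ hs1
    have hhom : IsHomothet A A' := isHomothet_dilate A x₀ hs0
    have hA'b := hhom.isConvexBody hA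
    have hA'μ := hμ.of_isHomothet hhom
    have hex : ∀ x ∈ A, ∃ u, 0 < u ∧ u ≤ 1 ∧ μ (dilate A' x u) = k := fun x hx =>
      exists_measure_dilate_eq hd hA'b hA'μ (interior_subset (hAA' hx)) one_pos hk0 (by
        rw [dilate_one]; exact hlt.le.trans (measure_mono (hAA'.trans interior_subset)))
    choose! u hu0 hu1 huk using hex
    obtain ⟨t, htA, htc⟩ := hA.isCompact.elim_nhds_subcover (fun x => dilate A' x (u x))
      fun x hx => mem_interior_iff_mem_nhds.1 (mem_interior_dilate (hAA' hx))
    refine ⟨_, (fun x => dilate A' x (u x)) '' t, t.finite_toSet.image _,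
      ⟨isHomothet_dilate A x₀ hu₀, hu₀k⟩, ?_, ?_⟩
    · rintro _ ⟨x, hx, rfl⟩
      have hxA := htA x hx
      refine ⟨⟨hhom.trans (isHomothet_dilate A' x (hu0 x hxA)), huk x hxA⟩, fun hsub => ?_⟩
      have h1 : dilate A' x (u x) ⊆ A' := by
        have := dilate_mono_right hA'b.convex (interior_subset (hAA' hxA)) (hu0 x hxA) (hu1 x hxA)
        rwa [dilate_one] at this
      rw [Measure.restrict_apply hA'b.measurableSet] at hs
      -- A set of measure `k` within `A'` cannot fit in the ball, where `A'` has measure below `k`.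
      have := measure_mono (μ := μ) (subset_inter h1 hsub)
      rw [huk x hxA] at this
      exact absurd hs (not_lt.2 this)
    · refine htc.trans (Subset.trans ?_ subset_union_right)
      rw [sUnion_image]
      rfl

/-- A large ball is covered by finitely many homothets of measure exactly `k`, of which only few are
contained in the ball. -/
theorem exists_finite_cover_ball (hd : 1 ≤ d) (hC : IsConvexBody C) (hμ : NonDegenerate C μ)
    (hinf : μ univ = ∞) {c : ℝ≥0∞} (hc : IsCoverBound d c) (hct : c ≠ ∞) {k : ℝ≥0∞} (hk : k ≠ ∞)
    {k' : ℝ≥0} (hk' : 0 < k') (hkk : (k' : ℝ≥0∞) < k) {r : ℝ} (hr : 0 < r)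
    (hkr : (k' : ℝ≥0∞) ≤ μ (Metric.ball 0 r)) :
    ∃ G : Set (Set (EuclideanSpace ℝ (Fin d))), G.Finite ∧
      (∀ B ∈ G, IsHomothet C B ∧ μ B = k) ∧ Metric.ball 0 r ⊆ ⋃₀ G ∧
      (({B ∈ G | B ⊆ Metric.ball 0 r}.encard : ℕ∞) : ℝ≥0∞) ≤ c * (μ (Metric.ball 0 r) / k') := by
  have hfin : μ (Metric.ball (0 : EuclideanSpace ℝ (Fin d)) r) < ∞ := measure_ball_lt_top
  have hb := hc C (μ.restrict (Metric.ball 0 r)) 0 r k' hC (by simpa using hfin) (hμ.restrict _) hr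
    (by simp) hk' (by simpa using hkr)
  rw [Measure.restrict_apply_univ] at hb
  have hbt : c * (μ (Metric.ball (0 : EuclideanSpace ℝ (Fin d)) r) / k') < ∞ :=
    ENNReal.mul_lt_top hct.lt_top (ENNReal.div_lt_top hfin.ne (by simpa using hk'.ne'))
  obtain ⟨F, ⟨hF, hcov⟩, hFle⟩ : ∃ F : Set (Set (EuclideanSpace ℝ (Fin d))),
      ((∀ A ∈ F, IsHomothet C A ∧ μ.restrict (Metric.ball 0 r) A ≤ k') ∧
        Metric.ball 0 r ⊆ ⋃₀ F) ∧
      -- An infimum in `ℕ∞` that is finite is attained.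
      F.encard ≤ coverNumber C k' (μ.restrict (Metric.ball 0 r)) (Metric.ball 0 r) := by
    by_contra! hcon
    have hlt : coverNumber C k' (μ.restrict (Metric.ball 0 r)) (Metric.ball 0 r) < ⊤ := by
      have := hb.trans_lt hbt
      rwa [← ENat.toENNReal_top, ENat.toENNReal_lt] at this
    exact lt_irrefl _ (((ENat.add_one_le_iff hlt.ne).1
      (le_iInf₂ fun F hF => Order.add_one_le_of_lt (hcon F hF))))
  have hFfin : F.Finite := by
    rw [← encard_ne_top_iff]
    intro htop
    have h1 := (ENat.toENNReal_le.2 hFle).trans hb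
    rw [htop, ENat.toENNReal_top] at h1
    exact absurd h1 (not_le.2 hbt)
  have hex : ∀ A ∈ F, ∃ (A₀ : Set (EuclideanSpace ℝ (Fin d)))
      (H : Set (Set (EuclideanSpace ℝ (Fin d)))), H.Finite ∧ (IsHomothet C A₀ ∧ μ A₀ = k) ∧
      (∀ B ∈ H, (IsHomothet C B ∧ μ B = k) ∧ ¬ B ⊆ Metric.ball 0 r) ∧ A ⊆ A₀ ∪ ⋃₀ H := by
    intro A hAF
    obtain ⟨hCA, hAk⟩ := hF A hAF
    have hAb := hCA.isConvexBody hC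
    rw [Measure.restrict_apply hAb.measurableSet] at hAk
    obtain ⟨A₀, H, hHf, hA₀, hH, hsub⟩ := exists_finite_cover_measure_eq hd hAb
      (hμ.of_isHomothet hCA) hinf hk r (hAk.trans_lt hkk)
    exact ⟨A₀, H, hHf, ⟨hCA.trans hA₀.1, hA₀.2⟩,
      fun B hB => ⟨⟨hCA.trans (hH B hB).1.1, (hH B hB).1.2⟩, (hH B hB).2⟩, hsub⟩
  choose! g H hHf hg hH hsub using hex
  refine ⟨g '' F ∪ ⋃ A ∈ F, H A, (hFfin.image g).union (hFfin.biUnion hHf), ?_, ?_, ?_⟩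
  · rintro B (⟨A, hA, rfl⟩ | hB)
    · exact hg A hA
    · obtain ⟨A, hA, hB⟩ := mem_iUnion₂.1 hB
      exact (hH A hA B hB).1
  · intro y hy
    obtain ⟨A, hA, hyA⟩ := hcov hy
    rcases hsub A hA hyA with h | ⟨B, hB, hyB⟩
    · exact ⟨g A, Or.inl (mem_image_of_mem g hA), h⟩
    · exact ⟨B, Or.inr (mem_biUnion hA hB), hyB⟩
  · refine le_trans (ENat.toENNReal_le.2 (le_trans ?_ ((encard_image_le g F).trans hFle))) hb
    refine encard_le_encard ?_
    rintro B ⟨hB | hB, hBr⟩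
    · exact hB
    · obtain ⟨A, hA, hB⟩ := mem_iUnion₂.1 hB
      exact absurd hBr (hH A hA B hB).2

end Density

/-- A slack `η` pays both for `k' < μ C` and for the sets of earlier stages, whose total measure is
at most `η` times that of a large ball; then `η → 0`. -/
theorem homothetyCoveringDensity_le {d : ℕ} (hd : 1 ≤ d) {c : ℝ≥0∞} (hc : IsCoverBound d c)
    (C : Set (EuclideanSpace ℝ (Fin d))) (μ : Measure (EuclideanSpace ℝ (Fin d)))
    [IsFiniteMeasureOnCompacts μ] (hC : IsConvexBody C) (hμ : NonDegenerate C μ) (hpos : 0 < μ C)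
    (hinf : μ univ = ∞) : homothetyCoveringDensity μ C ≤ c := by
  rcases eq_or_ne c ∞ with rfl | hct
  · exact le_top
  have hk : μ C ≠ ∞ := hC.isCompact.measure_lt_top.ne
  have hη : ∀ η : ℝ≥0, 0 < η → homothetyCoveringDensity μ C ≤ η + c * (1 + η) := by
    intro η hη
    refine homothetyCoveringDensity_le_of_forall_exists fun r S hSf => ?_
    set k' : ℝ≥0 := (μ C).toNNReal / (1 + η) with hk'
    have hkn : 0 < (μ C).toNNReal := ENNReal.toNNReal_pos hpos.ne' hk
    have hk'0 : 0 < k' := by positivity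
    have hkk : (k' : ℝ≥0∞) < μ C := by
      rw [← ENNReal.coe_toNNReal hk, ENNReal.coe_lt_coe]
      exact div_lt_self hkn (by simpa using hη)
    have hev := tendsto_measure_ball_atTop μ 0
    rw [hinf] at hev
    have hSt : (S.encard : ℝ≥0∞) * μ C / η < ∞ := by
      refine ENNReal.div_lt_top (ENNReal.mul_ne_top ?_ hk) (by simpa using hη.ne')
      simpa using hSf
    obtain ⟨r', h1, h2, h3, h4⟩ := ((hev.eventually_const_lt hSt).and
      ((hev.eventually_const_lt (ENNReal.coe_lt_top (r := k'))).and
      ((eventually_ge_atTop (r + 1)).and (eventually_gt_atTop 0)))).exists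
    obtain ⟨G, hGf, hGC, hGcov, hGle⟩ :=
      exists_finite_cover_ball hd hC hμ hinf hc hct hk hk'0 hkk h4 h2.le
    refine ⟨r', G, h3, hGf, hGC, hGcov, ?_⟩
    rw [add_mul, add_mul]
    refine add_le_add ?_ ?_
    · rw [mul_comm (η : ℝ≥0∞)]
      exact (ENNReal.div_le_iff (by simpa using hη.ne') (by simp)).1 h1.le
    · calc _ ≤ c * (μ (Metric.ball 0 r') / k') * μ C := mul_le_mul_left hGle _
        _ = c * (1 + η) * μ (Metric.ball 0 r') := by
          have hC' : μ C = (1 + η) * k' := by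
            rw [← ENNReal.coe_toNNReal hk]
            norm_cast
            rw [hk', mul_div_cancel₀ _ (by positivity)]
          rw [hC', div_eq_mul_inv]
          calc _ = c * (1 + η) * μ (Metric.ball 0 r') * ((k' : ℝ≥0∞)⁻¹ * k') := by ring
            _ = _ := by rw [ENNReal.inv_mul_cancel (by simpa using hk'0.ne') (by simp), mul_one]
  have hlim : Tendsto (fun η : ℝ≥0 => (η : ℝ≥0∞) + c * (1 + η)) (𝓝[>] 0) (𝓝 (0 + c * (1 + 0))) := by
    have h0 : Tendsto (fun η : ℝ≥0 => (η : ℝ≥0∞)) (𝓝[>] 0) (𝓝 0) := by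
      have : Continuous fun η : ℝ≥0 => (η : ℝ≥0∞) := ENNReal.continuous_coe
      exact (this.tendsto' 0 0 rfl).mono_left nhdsWithin_le_nhds
    exact h0.add (ENNReal.Tendsto.const_mul (tendsto_const_nhds.add h0) (Or.inr hct))
  rw [zero_add, add_zero, mul_one] at hlim
  exact ge_of_tendsto hlim (eventually_mem_nhdsWithin.mono fun η h => hη η h)

theorem mainTheorem4 (d : ℕ) (hd : 1 ≤ d) :
    coverConstant d < ∞ ∧
    ∀ (C : Set (EuclideanSpace ℝ (Fin d))) (μ : Measure (EuclideanSpace ℝ (Fin d)))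
      [IsFiniteMeasureOnCompacts μ],
      IsConvexBody C → NonDegenerate C μ → 0 < μ C → μ univ = ∞ →
      homothetyCoveringDensity μ C ≤ coverConstant d :=
  ⟨(sInf_le (isCoverBound_natCast hd)).trans_lt (ENNReal.natCast_lt_top _),
    fun C μ _ hC hμ hpos hinf =>
      -- The bound holds for every admissible constant, so the infimum need not be shown to be
      -- admissible.
      le_sInf fun _ hc => homothetyCoveringDensity_le hd hc C μ hC hμ hpos hinf⟩
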